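/- Conventions. Let $R$ be a ring, $\mathbb N=\{0,1,2,\dots\}$, and let $\tau=(\tau_n)_{n\in\mathbb N}$, $\delta=(\delta_n)_{n\in\mathbb N}$ be families of additive maps $R\to R$ with $\tau_0=\delta_0=\mathrm{id}_R$. The family $\tau$ is a *higher derivation* if $\tau_n(AB)=\sum_{i+j=n}\tau_i(A)\tau_j(B)$ for all $n\in\mathbb N$, $A,B\in R$; a *Jordan higher derivation* if $\tau_n(A^2)=\sum_{i+j=n}\tau_i(A)\tau_j(A)$ for all $n\in\mathbb N$, $A\in R$; a *Jordan triple higher derivation* if $\tau_n(ABA)=\sum_{i+j+k=n}\tau_i(A)\tau_j(B)\tau_k(A)$ for all $n\in\mathbb N$, $A,B\in R$. The family $\delta$ is a *generalized higher derivation* if there is a higher derivation $\tau$ with $\delta_n(AB)=\sum_{i+j=n}\delta_i(A)\tau_j(B)$ for all $n\in\mathbb N$, $A,B\in R$; a *generalized Jordan higher derivation* if there is a Jordan higher derivation $\tau$ with $\delta_n(A^2)=\sum_{i+j=n}\delta_i(A)\tau_j(A)$ for all $n\in\mathbb N$, $A\in R$; a *generalized Jordan triple higher derivation* if there is a Jordan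 triple higher derivation $\tau$ with $\delta_n(ABA)=\sum_{i+j+k=n}\delta_i(A)\tau_j(B)\tau_k(A)$ for all $n\in\mathbb N$, $A,B\in R$. A *nest* $\mathcal N$ on a real or complex Banach space $X$ is a chain of closed subspaces of $X$ that contains $\{0\}$ and $X$ and is closed under arbitrary closed linear spans and intersections; its *nest algebra* is $\mathrm{Alg}\,\mathcal N=\{T\in\mathcal B(X): TN\subseteq N\text{ for all }N\in\mathcal N\}$, where $\mathcal B(X)$ is the algebra of bounded linear operators on $X$. **Theorem 3.3.** Let $\mathcal N$ be either (a) a nest on a real or complex Banach space $X$ such that some $N\in\mathcal N$ with $\{0\}\ne N\ne X$ is complemented in $X$ (i.e. is the range of a bounded linear projection on $X$), or (b) any nest on a real or complex Hilbert space (the trivial nest $\{\{0\},H\}$ included). Then every generalized Jordan higher derivation on the ring $\mathrm{Alg}\,\mathcal N$, and every generalized Jordan triple higher derivation on it, is a generalized higher derivation. -/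

import Mathlib

section HigherDerivations

variable {R : Type*} [Ring R]

/-- A higher derivation of a ring `R`: a sequence of additive maps with `τ 0 = id` and
`τ n (A B) = ∑_{i+j=n} τ i A * τ j B`. -/
structure IsHigherDerivation (τ : ℕ → R →+ R) : Prop where
  zero : τ 0 = AddMonoidHom.id R
  map_mul : ∀ (n : ℕ) (A B : R),
    τ n (A * B) = ∑ p ∈ Finset.HasAntidiagonal.antidiagonal n, τ p.1 A * τ p.2 B

/-- A Jordan higher derivation of a ring `R`. -/
structure IsJordanHigherDerivation (τ : ℕ → R →+ R) : Prop where
  zero : τ 0 = AddMonoidHom.id R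
  map_sq : ∀ (n : ℕ) (A : R),
    τ n (A * A) = ∑ p ∈ Finset.HasAntidiagonal.antidiagonal n, τ p.1 A * τ p.2 A

/-- A Jordan triple higher derivation of a ring `R`; the double sum runs over all
`(i, j, k)` with `i + j + k = n`. -/
structure IsJordanTripleHigherDerivation (τ : ℕ → R →+ R) : Prop where
  zero : τ 0 = AddMonoidHom.id R
  map_triple : ∀ (n : ℕ) (A B : R),
    τ n (A * B * A) = ∑ p ∈ Finset.HasAntidiagonal.antidiagonal n, ∑ q ∈ Finset.HasAntidiagonal.antidiagonal p.2,
      τ p.1 A * τ q.1 B * τ q.2 A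

/-- A generalized higher derivation of a ring `R`. -/
structure IsGeneralizedHigherDerivation (δ : ℕ → R →+ R) : Prop where
  zero : δ 0 = AddMonoidHom.id R
  exists_relating : ∃ τ : ℕ → R →+ R, IsHigherDerivation τ ∧ ∀ (n : ℕ) (A B : R),
    δ n (A * B) = ∑ p ∈ Finset.HasAntidiagonal.antidiagonal n, δ p.1 A * τ p.2 B

/-- A generalized Jordan higher derivation of a ring `R`. -/
structure IsGeneralizedJordanHigherDerivation (δ : ℕ → R →+ R) : Prop where
  zero : δ 0 = AddMonoidHom.id R
  exists_relating : ∃ τ : ℕ → R →+ R, IsJordanHigherDerivation τ ∧ ∀ (n : ℕ) (A : R),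
    δ n (A * A) = ∑ p ∈ Finset.HasAntidiagonal.antidiagonal n, δ p.1 A * τ p.2 A

/-- A generalized Jordan triple higher derivation of a ring `R`. -/
structure IsGeneralizedJordanTripleHigherDerivation (δ : ℕ → R →+ R) : Prop where
  zero : δ 0 = AddMonoidHom.id R
  exists_relating : ∃ τ : ℕ → R →+ R, IsJordanTripleHigherDerivation τ ∧
    ∀ (n : ℕ) (A B : R),
      δ n (A * B * A) = ∑ p ∈ Finset.HasAntidiagonal.antidiagonal n, ∑ q ∈ Finset.HasAntidiagonal.antidiagonal p.2,
        δ p.1 A * τ q.1 B * τ q.2 A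

end HigherDerivations

section Nests

variable {𝕜 X : Type*} [RCLike 𝕜] [NormedAddCommGroup X] [NormedSpace 𝕜 X]

/-- A nest: a chain of closed subspaces containing `{0}` and `X` and closed under arbitrary
closed linear spans and intersections. -/
structure IsNest (N : Set (Submodule 𝕜 X)) : Prop where
  isClosed : ∀ M ∈ N, IsClosed (M : Set X)
  isChain : IsChain (· ≤ ·) N
  bot_mem : ⊥ ∈ N
  top_mem : ⊤ ∈ N
  closedSpan_mem : ∀ S ⊆ N, (sSup S).topologicalClosure ∈ N
  sInf_mem : ∀ S ⊆ N, sInf S ∈ N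

/-- The algebra of all bounded operators leaving every member of `N` invariant. -/
def nestAlgebra (N : Set (Submodule 𝕜 X)) : Subalgebra 𝕜 (X →L[𝕜] X) where
  carrier := {T | ∀ M ∈ N, ∀ x ∈ M, T x ∈ M}
  mul_mem' := fun hS hT M hM x hx => hS M hM _ (hT M hM x hx)
  add_mem' := fun hS hT M hM x hx => M.add_mem (hS M hM x hx) (hT M hM x hx)
  algebraMap_mem' := fun c M _ x hx => by
    simpa [Algebra.algebraMap_eq_smul_one] using M.smul_mem c hx

end Nests

/-! Collect a Jordan higher derivation `τ` into the series `D A = ∑ τ n A X ^ n`, so that `D (A * A)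
= D A * D A`. The defect `D (A * B) - D A * D B` is biadditive and alternating, and associativity
makes it a 2-cocycle twisted by `D`. Since `τ 0 = id`, the twist disappears in lowest degree: if all
coefficients below `n` vanish, the `n`-th is an ordinary alternating Hochschild cocycle `R × R → R`.
If `R` has no 2-torsion and has a faithful idempotent, every such cocycle is zero
(`IsAlternatingCocycle.eq_zero`), so by induction `τ` is a higher derivation.

A nest algebra contains a faithful idempotent: the projection onto a nontrivial complemented member
of the nest or, for the trivial nest on a Hilbert space of dimension at least 2, a rank-one
projection. In dimension at most 1 the algebra is commutative, and the defect is both symmetric and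
alternating.

The generalized statements reduce to this one. Putting `B = 1` turns the triple identity into the
Jordan one, because `D 1 = 1`; and polarizing at `1` shows that the series of `δ` is that of `δ` at
`1` times `D`. -/

/-! ### Vanishing of alternating 2-cocycles. -/

section AlternatingCocycles

variable {R : Type*} [Ring R]

/-- An idempotent `e` such that `e R (1 - e)` is faithful on both sides, and such that a product
of an element of `(1 - e) R e` with an element of `e R (1 - e)` vanishes only trivially. -/
structure IsFaithfulIdempotent (e : R) : Prop where
  idem : e * e = e
  left_faithful : ∀ a, e * a = a → a * e = a →
    (∀ x, e * x = x → x * e = 0 → a * x = 0) → a = 0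
  right_faithful : ∀ b, e * b = 0 → b * e = 0 →
    (∀ x, e * x = x → x * e = 0 → x * b = 0) → b = 0
  eq_zero_or_eq_zero : ∀ x y, e * x = x → x * e = 0 → e * y = 0 → y * e = y →
    y * x = 0 → x = 0 ∨ y = 0

/-- An alternating biadditive Hochschild `2`-cocycle of a ring with values in the ring. -/
structure IsAlternatingCocycle (Φ : R →+ R →+ R) : Prop where
  self : ∀ a, Φ a a = 0
  cocycle : ∀ a b c, Φ a b * c + Φ (a * b) c = a * Φ b c + Φ a (b * c)

namespace IsAlternatingCocycle

variable {Φ : R →+ R →+ R}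

theorem skew (h : IsAlternatingCocycle Φ) (a b : R) : Φ a b = -Φ b a := by
  have := h.self (a + b)
  simp only [map_add, AddMonoidHom.add_apply, h.self, zero_add, add_zero] at this
  exact eq_neg_of_add_eq_zero_right this

theorem map_sq (h : IsAlternatingCocycle Φ) (a c : R) :
    Φ (a * a) c = a * Φ a c + Φ a (a * c) := by
  simpa [h.self] using h.cocycle a a c

/-- The cocycle identities at `(a, a, c)`, `(c, a, a)` and `(a, c, a)`, combined by skew-symmetry,
give twice the difference of the two sides equal to zero. -/
theorem map_mul_self_left (h : IsAlternatingCocycle Φ) (h2 : ∀ a : R, a + a = 0 → a = 0)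
    (a c : R) : Φ a (a * c) = Φ a c * a := by
  have h1 := h.map_sq a c
  have h3 := h.cocycle c a a
  have h4 := h.cocycle a c a
  rw [h.self, mul_zero, zero_add, h.skew c a, h.skew c (a * a), h.skew (c * a) a, h1] at h3
  rw [h.skew (a * c) a, h.skew c a] at h4
  rw [← sub_eq_zero]
  apply h2
  have h5 : Φ a (c * a) = a * Φ a c + Φ a (a * c) - Φ a c * a := by
    rw [eq_sub_iff_add_eq, ← neg_inj, ← h3]
    noncomm_ring
  rw [h5] at h4
  rw [← sub_eq_zero] at h4
  rw [← neg_eq_zero, ← h4]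
  noncomm_ring

theorem map_mul_self_right (h : IsAlternatingCocycle Φ) (h2 : ∀ a : R, a + a = 0 → a = 0)
    (a c : R) : Φ a (c * a) = a * Φ a c := by
  have h1 := h.map_mul_self_left h2 a c
  have h4 := h.cocycle a c a
  rw [h.skew (a * c) a, h.skew c a, h1, add_neg_cancel, mul_neg] at h4
  exact (neg_add_eq_zero.mp h4.symm).symm

theorem idem_add (h : IsAlternatingCocycle Φ) (h2 : ∀ a : R, a + a = 0 → a = 0) {e : R}
    (he : e * e = e) (c : R) : e * Φ e c + Φ e c * e = Φ e c := by
  have := h.map_sq e c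
  rw [he, h.map_mul_self_left h2] at this
  exact this.symm

/-- The value `Φ e x` lies in `(1 - e) R e`. Since `e + x` is again idempotent, `idem_add` applies
to it and relates the two products of `x` with `Φ e x`. -/
theorem map_idem_left (h : IsAlternatingCocycle Φ) (h2 : ∀ a : R, a + a = 0 → a = 0) {e : R}
    (he : IsFaithfulIdempotent e) {x : R} (hx : e * x = x) (hx' : x * e = 0) : Φ e x = 0 := by
  have h1 := h.map_mul_self_left h2 e x
  have h3 := h.map_mul_self_right h2 e x
  rw [hx] at h1
  rw [hx', map_zero] at h3
  have hxx : x * x = 0 := by rw [← hx, ← mul_assoc, mul_assoc e, hx', mul_zero, zero_mul]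
  have h4 := h.idem_add h2 (e := e + x) (by simp [add_mul, mul_add, he.idem, hx, hx', hxx]) x
  simp only [map_add, AddMonoidHom.add_apply, h.self, add_zero, add_mul, mul_add, ← h3, ← h1,
    zero_add] at h4
  have h5 : x * Φ e x + Φ e x * x = 0 := by
    rw [add_left_comm, add_eq_left] at h4
    exact h4
  -- Multiplication by `e` kills `Φ e x * x`, so both products vanish separately.
  have h6 := congrArg (e * ·) h5
  simp only [mul_add, ← mul_assoc, hx, ← h3, zero_mul, add_zero, mul_zero] at h6
  rw [h6, zero_add] at h5
  rcases he.eq_zero_or_eq_zero x (Φ e x) hx hx' h3.symm h1.symm h5 with h7 | h7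
  · rw [h7, map_zero]
  · exact h7

theorem map_idem_right (h : IsAlternatingCocycle Φ) (h2 : ∀ a : R, a + a = 0 → a = 0) {e : R}
    (he : IsFaithfulIdempotent e) {y : R} (hy : e * y = 0) (hy' : y * e = y) : Φ e y = 0 := by
  have h1 := h.map_mul_self_left h2 e y
  have h3 := h.map_mul_self_right h2 e y
  rw [hy, map_zero] at h1
  rw [hy'] at h3
  have hyy : y * y = 0 := by rw [← hy', mul_assoc, ← mul_assoc e, hy, zero_mul, mul_zero]
  have h4 := h.idem_add h2 (e := e + y) (by simp [add_mul, mul_add, he.idem, hy, hy', hyy]) y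
  simp only [map_add, AddMonoidHom.add_apply, h.self, add_zero, add_mul, mul_add, ← h3, ← h1,
    zero_add] at h4
  have h5 : y * Φ e y + Φ e y * y = 0 := by
    rw [add_assoc, add_eq_left] at h4
    exact h4
  have h6 := congrArg (e * ·) h5
  simp only [mul_add, ← mul_assoc, hy, ← h3, zero_mul, zero_add, mul_zero] at h6
  rw [h6, add_zero] at h5
  rcases he.eq_zero_or_eq_zero (Φ e y) y h3.symm h1.symm hy hy' h5 with h7 | h7
  · exact h7
  · rw [h7, map_zero]

/-- Peirce decomposition: the off-diagonal corners of `c` are covered by the two preceding lemmas,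
and these force both `Φ e c * e` and `e * Φ e c` to vanish. -/
theorem map_idem (h : IsAlternatingCocycle Φ) (h2 : ∀ a : R, a + a = 0 → a = 0) {e : R}
    (he : IsFaithfulIdempotent e) (c : R) : Φ e c = 0 := by
  have hadd := h.idem_add h2 he.idem c
  have h0 : e * Φ e c * e = 0 := by
    have h1 := congrArg (fun z => e * z * e) hadd
    simp only [mul_add, add_mul, mul_assoc, he.idem] at h1
    simp only [← mul_assoc, he.idem] at h1
    simpa using h1
  have h1 : Φ e (e * c - e * c * e) = 0 := h.map_idem_left h2 he
    (by simp only [mul_sub, ← mul_assoc, he.idem])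
    (by simp only [sub_mul, mul_assoc, he.idem, sub_self])
  have h3 : Φ e (c * e - e * c * e) = 0 := h.map_idem_right h2 he
    (by simp only [mul_sub, ← mul_assoc, he.idem, sub_self])
    (by simp only [sub_mul, mul_assoc, he.idem])
  have h4 : Φ e (e * c * e) = 0 := by
    rw [h.map_mul_self_right h2, h.map_mul_self_left h2, ← mul_assoc, h0]
  rw [map_sub, h4, sub_zero, h.map_mul_self_left h2] at h1
  rw [map_sub, h4, sub_zero, h.map_mul_self_right h2] at h3
  rw [← hadd, h1, h3, add_zero]

/-- An alternating cocycle vanishes on a ring with a faithful idempotent. -/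
theorem eq_zero (h : IsAlternatingCocycle Φ) (h2 : ∀ a : R, a + a = 0 → a = 0) {e : R}
    (he : IsFaithfulIdempotent e) (a b : R) : Φ a b = 0 := by
  have hl : ∀ c, Φ e c = 0 := h.map_idem h2 he
  have hr : ∀ c, Φ c e = 0 := fun c => by rw [h.skew, hl, neg_zero]
  have el : ∀ a b, Φ (e * a) b = e * Φ a b := fun a b => by simpa [hl] using h.cocycle e a b
  have er : ∀ a b, Φ a (b * e) = Φ a b * e := fun a b => by
    simpa [hr] using (h.cocycle a b e).symm
  have el' : ∀ a b, Φ a (e * b) = e * Φ a b := fun a b => by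
    rw [h.skew, el, h.skew b a, mul_neg, neg_neg]
  have er' : ∀ a b, Φ (a * e) b = Φ a b * e := fun a b => by
    rw [h.skew, er, h.skew b a, neg_mul, neg_neg]
  -- All values of `Φ` commute with `e`, while `Φ` respects multiplication by `e` on either side;
  -- hence `Φ` vanishes as soon as one argument lies in `e R (1 - e)`.
  have hc : ∀ a b, e * Φ a b = Φ a b * e := fun a b => by
    rw [← er', ← el']
    simpa [hr, hl] using (h.cocycle a e b).symm
  have xr : ∀ x, e * x = x → x * e = 0 → ∀ a, Φ a x = 0 := fun x hx hx' a => by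
    rw [← hx, el', hc, ← er, hx', map_zero]
  have xl : ∀ x, e * x = x → x * e = 0 → ∀ a, Φ x a = 0 := fun x hx hx' a => by
    rw [h.skew, xr x hx hx', neg_zero]
  have h1 : e * Φ a b = 0 := by
    refine he.left_faithful _ (by rw [← mul_assoc, he.idem])
      (by rw [hc, mul_assoc, he.idem]) fun x hx hx' => ?_
    -- Three of the four terms have an argument in `e R (1 - e)`; what remains is `e * Φ a b * x =
    -- 0`.
    have h3 := h.cocycle a (e * b) x
    rw [xr x hx hx', xr x hx hx', xr (e * b * x) (by simp only [← mul_assoc, he.idem])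
      (by simp only [mul_assoc, hx', mul_zero])] at h3
    simpa [el'] using h3
  have h3 : Φ a b - e * Φ a b = 0 := by
    refine he.right_faithful _ (by rw [mul_sub, ← mul_assoc, he.idem, sub_self])
      (by rw [sub_mul, mul_assoc, ← hc, ← mul_assoc, he.idem, sub_self]) fun x hx hx' => ?_
    -- The factor `1 - e` keeps `x * (a - a * e)` in `e R (1 - e)`; what remains is `x * (Φ a b - e
    -- * Φ a b) = 0`.
    have h4 := h.cocycle x (a - a * e) b
    rw [xl x hx hx', xl x hx hx', xl (x * (a - a * e)) (by simp only [← mul_assoc, hx])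
      (by simp only [mul_assoc, sub_mul, he.idem, sub_self, mul_zero])] at h4
    have h5 := h4.symm
    rw [map_sub, AddMonoidHom.sub_apply, er', ← hc] at h5
    simpa using h5
  rwa [h1, sub_zero] at h3

end IsAlternatingCocycle

end AlternatingCocycles

/-! ### Generating series and reduction to cocycles. -/

section GeneratingSeries

open PowerSeries

variable {R : Type*} [Ring R]

/-- The generating series `A ↦ ∑ τ n A X ^ n` of a sequence of additive maps. -/
def genSeries (τ : ℕ → R →+ R) : R →+ R⟦X⟧ where
  toFun A := PowerSeries.mk fun n => τ n A
  map_zero' := by ext n; simp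
  map_add' A B := by ext n; simp

@[simp]
theorem coeff_genSeries (τ : ℕ → R →+ R) (n : ℕ) (A : R) :
    coeff n (genSeries τ A) = τ n A := by
  simp [genSeries]

theorem coeff_genSeries_mul (σ τ : ℕ → R →+ R) (n : ℕ) (A B : R) :
    coeff n (genSeries σ A * genSeries τ B) =
      ∑ p ∈ Finset.HasAntidiagonal.antidiagonal n, σ p.1 A * τ p.2 B := by
  simp [coeff_mul]

theorem coeff_genSeries_mul_mul (ρ σ τ : ℕ → R →+ R) (n : ℕ) (A B C : R) :
    coeff n (genSeries ρ A * genSeries σ B * genSeries τ C) =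
      ∑ p ∈ Finset.HasAntidiagonal.antidiagonal n,
        ∑ q ∈ Finset.HasAntidiagonal.antidiagonal p.2, ρ p.1 A * σ q.1 B * τ q.2 C := by
  rw [mul_assoc, coeff_mul]
  refine Finset.sum_congr rfl fun p _ => ?_
  rw [coeff_genSeries_mul, Finset.mul_sum, coeff_genSeries]
  simp only [mul_assoc]

theorem coeff_mul_of_forall_lt_left {f : R⟦X⟧} {n : ℕ} (hf : ∀ k < n, coeff k f = 0)
    (g : R⟦X⟧) : coeff n (f * g) = coeff n f * coeff 0 g := by
  rw [coeff_mul, Finset.sum_eq_single (n, 0)]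
  · rintro ⟨i, j⟩ hij hne
    rw [Finset.HasAntidiagonal.mem_antidiagonal] at hij
    rw [hf i, zero_mul]
    rcases eq_or_ne j 0 with rfl | hj
    · exact absurd (by simpa using hij) hne
    · simp only at hij
      omega
  · simp

theorem coeff_mul_of_forall_lt_right {g : R⟦X⟧} {n : ℕ} (hg : ∀ k < n, coeff k g = 0)
    (f : R⟦X⟧) : coeff n (f * g) = coeff 0 f * coeff n g := by
  rw [coeff_mul, Finset.sum_eq_single (0, n)]
  · rintro ⟨i, j⟩ hij hne
    rw [Finset.HasAntidiagonal.mem_antidiagonal] at hij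
    rw [hg j, mul_zero]
    rcases eq_or_ne i 0 with rfl | hi
    · exact absurd (by simpa using hij) hne
    · simp only at hij
      omega
  · simp

theorem eq_zero_of_mul_eq_zero_of_coeff_zero {f g : R⟦X⟧} (hfg : f * g = 0)
    (hg : ∀ a : R, a * coeff 0 g = 0 → a = 0) : f = 0 := by
  ext n
  induction n using Nat.strong_induction_on with
  | _ n ih =>
    refine hg _ ?_
    rw [← coeff_mul_of_forall_lt_left (fun k hk => by simpa using ih k hk), hfg, map_zero]

/-- The generating series of a Jordan triple higher derivation maps `1` to `1`. -/
theorem IsJordanTripleHigherDerivation.genSeries_one (h2 : ∀ a : R, a + a = 0 → a = 0)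
    {τ : ℕ → R →+ R} (h : IsJordanTripleHigherDerivation τ) : genSeries τ 1 = 1 := by
  have h1 : genSeries τ 1 = genSeries τ 1 * genSeries τ 1 * genSeries τ 1 := by
    ext n
    rw [coeff_genSeries_mul_mul, ← h.map_triple, coeff_genSeries, one_mul, one_mul]
  rw [← sub_eq_zero]
  -- With `s = genSeries τ 1`, `s = s ^ 3` factors as `(s - 1) * (s * s + s) = 0`; the second factor
  -- has constant term `2`.
  refine eq_zero_of_mul_eq_zero_of_coeff_zero
    (g := genSeries τ 1 * genSeries τ 1 + genSeries τ 1) ?_ fun a ha => h2 a ?_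
  · simp only [sub_mul, mul_add, one_mul, ← mul_assoc]
    rw [← h1]
    abel
  · rw [map_add, coeff_genSeries_mul] at ha
    simpa [h.zero, mul_add] using ha

/-- The generating series of a Jordan higher derivation maps `1` to `1`. -/
theorem IsJordanHigherDerivation.genSeries_one {τ : ℕ → R →+ R}
    (h : IsJordanHigherDerivation τ) : genSeries τ 1 = 1 := by
  have h1 : genSeries τ 1 = genSeries τ 1 * genSeries τ 1 := by
    ext n
    rw [coeff_genSeries_mul, ← h.map_sq, coeff_genSeries, one_mul]
  rw [← sub_eq_zero]
  refine eq_zero_of_mul_eq_zero_of_coeff_zero (g := genSeries τ 1) ?_ fun a ha => ?_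
  · rw [sub_mul, ← h1, one_mul, sub_self]
  · simpa [h.zero] using ha

/-- In a unital ring without `2`-torsion, a generalized Jordan triple higher derivation is a
generalized Jordan higher derivation. -/
theorem IsGeneralizedJordanTripleHigherDerivation.isGeneralizedJordanHigherDerivation
    (h2 : ∀ a : R, a + a = 0 → a = 0) {δ : ℕ → R →+ R}
    (h : IsGeneralizedJordanTripleHigherDerivation δ) :
    IsGeneralizedJordanHigherDerivation δ := by
  obtain ⟨τ, hτ, hδ⟩ := h.exists_relating
  refine ⟨h.zero, τ, ⟨hτ.zero, fun n A => ?_⟩, fun n A => ?_⟩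
  · have h1 := coeff_genSeries_mul_mul τ τ τ n A 1 A
    rw [← hτ.map_triple, hτ.genSeries_one h2, mul_one, mul_one] at h1
    rw [← h1, coeff_genSeries_mul]
  · have h1 := coeff_genSeries_mul_mul δ τ τ n A 1 A
    rw [← hδ, hτ.genSeries_one h2, mul_one, mul_one] at h1
    rw [← h1, coeff_genSeries_mul]

theorem IsJordanHigherDerivation.genSeries_sq {τ : ℕ → R →+ R}
    (h : IsJordanHigherDerivation τ) (A : R) :
    genSeries τ (A * A) = genSeries τ A * genSeries τ A := by
  ext n
  rw [coeff_genSeries_mul, ← h.map_sq, coeff_genSeries]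

/-- The failure of the generating series of `τ` to be multiplicative. -/
noncomputable def multDefect (τ : ℕ → R →+ R) : R →+ R →+ R⟦X⟧ :=
  AddMonoidHom.mk' (fun A => AddMonoidHom.mk'
    (fun B => genSeries τ (A * B) - genSeries τ A * genSeries τ B)
    fun B C => by simp only [mul_add, map_add]; abel)
    fun A B => by ext C : 1; simp only [AddMonoidHom.mk'_apply, AddMonoidHom.add_apply,
      add_mul, map_add]; abel

theorem multDefect_apply (τ : ℕ → R →+ R) (A B : R) :
    multDefect τ A B = genSeries τ (A * B) - genSeries τ A * genSeries τ B := rfl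

theorem IsJordanHigherDerivation.multDefect_self {τ : ℕ → R →+ R}
    (h : IsJordanHigherDerivation τ) (A : R) : multDefect τ A A = 0 := by
  rw [multDefect_apply, h.genSeries_sq, sub_self]

theorem multDefect_cocycle (τ : ℕ → R →+ R) (A B C : R) :
    multDefect τ A B * genSeries τ C + multDefect τ (A * B) C =
      genSeries τ A * multDefect τ B C + multDefect τ A (B * C) := by
  simp only [multDefect_apply, sub_mul, mul_sub, mul_assoc]
  abel

theorem IsJordanHigherDerivation.isHigherDerivation_of_multDefect {τ : ℕ → R →+ R}
    (h : IsJordanHigherDerivation τ) (hd : ∀ A B, multDefect τ A B = 0) :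
    IsHigherDerivation τ := by
  refine ⟨h.zero, fun n A B => ?_⟩
  rw [← coeff_genSeries_mul, ← coeff_genSeries, ← sub_eq_zero, ← map_sub, ← multDefect_apply,
    hd, map_zero]

/-- On a ring with a faithful idempotent, Jordan higher derivations are higher derivations. -/
theorem IsJordanHigherDerivation.isHigherDerivation (h2 : ∀ a : R, a + a = 0 → a = 0) {e : R}
    (he : IsFaithfulIdempotent e) {τ : ℕ → R →+ R} (h : IsJordanHigherDerivation τ) :
    IsHigherDerivation τ := by
  refine h.isHigherDerivation_of_multDefect ?_
  suffices H : ∀ n A B, coeff n (multDefect τ A B) = 0 from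
    fun A B => PowerSeries.ext fun n => by rw [H, map_zero]
  intro n
  induction n using Nat.strong_induction_on with
  | _ n ih =>
    let Φ : R →+ R →+ R := AddMonoidHom.mk' (fun A => AddMonoidHom.mk'
      (fun B => coeff n (multDefect τ A B)) fun B C => by simp only [map_add])
      fun A B => by ext C : 1; simp
    have hΦ : ∀ A B, Φ A B = coeff n (multDefect τ A B) := fun A B => rfl
    have hc : IsAlternatingCocycle Φ := by
      refine ⟨fun a => by rw [hΦ, h.multDefect_self, map_zero], fun a b c => ?_⟩
      have h1 := congrArg (coeff n) (multDefect_cocycle τ a b c)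
      rw [map_add, map_add, coeff_mul_of_forall_lt_left fun k hk => ih k hk a b,
        coeff_mul_of_forall_lt_right fun k hk => ih k hk b c] at h1
      simp only [coeff_genSeries, h.zero, AddMonoidHom.id_apply] at h1
      exact h1
    exact fun A B => hc.eq_zero h2 he A B

/-- On a commutative ring, Jordan higher derivations are higher derivations. -/
theorem IsJordanHigherDerivation.isHigherDerivation_of_comm
    (h2 : ∀ a : R, a + a = 0 → a = 0) (hcomm : ∀ a b : R, a * b = b * a)
    {τ : ℕ → R →+ R} (h : IsJordanHigherDerivation τ) : IsHigherDerivation τ := by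
  refine h.isHigherDerivation_of_multDefect fun A B => ?_
  have hs : multDefect τ B A = multDefect τ A B := by
    rw [multDefect_apply, multDefect_apply, hcomm B A]
    congr 1
    ext n
    rw [coeff_mul, coeff_mul, ← Finset.Nat.sum_antidiagonal_swap]
    exact Finset.sum_congr rfl fun p _ => hcomm _ _
  have h1 := h.multDefect_self (A + B)
  simp only [map_add, AddMonoidHom.add_apply, h.multDefect_self, zero_add, add_zero, hs] at h1
  ext n
  exact h2 _ (by rw [← map_add, h1, map_zero])

/-- If all Jordan higher derivations of a ring are higher derivations, then all generalized
Jordan higher derivations are generalized higher derivations. -/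
theorem IsGeneralizedJordanHigherDerivation.isGeneralizedHigherDerivation
    (hR : ∀ τ : ℕ → R →+ R, IsJordanHigherDerivation τ → IsHigherDerivation τ)
    {δ : ℕ → R →+ R} (h : IsGeneralizedJordanHigherDerivation δ) :
    IsGeneralizedHigherDerivation δ := by
  obtain ⟨τ, hτ, hδ⟩ := h.exists_relating
  have hτ' := hR τ hτ
  refine ⟨h.zero, τ, hτ', fun n A B => ?_⟩
  have hmul : ∀ A B, genSeries τ (A * B) = genSeries τ A * genSeries τ B := fun A B => by
    ext n
    rw [coeff_genSeries_mul, ← hτ'.map_mul, coeff_genSeries]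
  have hsq : ∀ A, genSeries δ (A * A) = genSeries δ A * genSeries τ A := fun A => by
    ext n
    rw [coeff_genSeries_mul, ← hδ, coeff_genSeries]
  have hone : ∀ A, genSeries δ A = genSeries δ 1 * genSeries τ A := fun A => by
    -- The linear part in `A` reads `δ A + δ A = δ A + δ 1 * τ A` for the series, so no division by
    -- 2 is needed.
    have h1 := hsq (A + 1)
    simp only [add_mul, mul_add, map_add, one_mul, mul_one, hsq A, hτ.genSeries_one] at h1
    rw [← sub_eq_zero] at h1 ⊢
    rw [← h1]
    abel
  rw [← coeff_genSeries_mul, hone A, mul_assoc, ← hmul, ← hone, coeff_genSeries]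

end GeneratingSeries

/-! ### Faithful idempotents in nest algebras. -/

section NestAlgebras

variable {𝕜 X : Type*} [RCLike 𝕜] [NormedAddCommGroup X] [NormedSpace 𝕜 X]
  {N : Set (Submodule 𝕜 X)}

theorem nestAlgebra_eq_zero_of_add_self (a : nestAlgebra N) (h : a + a = 0) : a = 0 := by
  rw [← two_smul 𝕜 a] at h
  exact (smul_eq_zero.mp h).resolve_left two_ne_zero

/-- A nontrivial idempotent `e` of the nest algebra is faithful as soon as the algebra contains
the rank-one operators with range in that of `e` and kernel containing that of `1 - e`. -/
theorem isFaithfulIdempotent_of_rankOne (e : nestAlgebra N) (idem : e * e = e) (h0 : e ≠ 0)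
    (h1 : e ≠ 1)
    (hrank : ∀ (f : X →L[𝕜] 𝕜) (u : X), (∀ z, f (e.1 z) = 0) → e.1 u = u →
      f.smulRight u ∈ nestAlgebra N)
    (hzero : ∀ x y : nestAlgebra N, e * x = x → x * e = 0 → e * y = 0 → y * e = y →
      y * x = 0 → x = 0 ∨ y = 0) : IsFaithfulIdempotent e := by
  have ee : ∀ z, e.1 (e.1 z) = e.1 z := fun z => congrArg (fun T => T.1 z) idem
  have key : ∀ (f : X →L[𝕜] 𝕜) (u : X), (∀ z, f (e.1 z) = 0) → e.1 u = u →
      ∃ x : nestAlgebra N, e * x = x ∧ x * e = 0 ∧ ∀ z, x.1 z = f z • u := by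
    intro f u hf hu
    refine ⟨⟨f.smulRight u, hrank f u hf hu⟩, ?_, ?_, fun z => rfl⟩
    · ext z
      change e.1 (f z • u) = f z • u
      rw [map_smul, hu]
    · ext z
      change f (e.1 z) • u = 0
      rw [hf, zero_smul]
  refine ⟨idem, fun a hea hae ha => ?_, fun b heb hbe hb => ?_, hzero⟩
  · obtain ⟨w, hw⟩ : ∃ w, e.1 w ≠ w := by
      by_contra! H
      exact h1 (Subtype.ext (ContinuousLinearMap.ext H))
    obtain ⟨g, -, hg⟩ := exists_dual_vector 𝕜 (w - e.1 w) 
      (norm_ne_zero_iff.mpr (sub_ne_zero.mpr hw.symm))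
    have hgne : g (w - e.1 w) ≠ 0 := by
      rw [hg]
      simpa [sub_eq_zero] using hw.symm
    ext z
    -- This `x` sends `w` to a nonzero multiple of `e z`, so `a * x = 0` forces `a` to kill `e z`.
    obtain ⟨x, hx, hx', hxz⟩ := key (g.comp (ContinuousLinearMap.id 𝕜 X - e.1)) (e.1 z)
      (fun z => by simp [ee]) (ee z)
    have h3 : a.1 (x.1 w) = 0 := congrArg (fun T => T.1 w) (ha x hx hx')
    rw [hxz, map_smul] at h3
    have h4 := (smul_eq_zero.mp h3).resolve_left (by simpa using hgne)
    have h5 : a.1 (e.1 z) = a.1 z := congrArg (fun T => T.1 z) hae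
    rw [← h5, h4]
    rfl
  · obtain ⟨w, hw⟩ : ∃ w, e.1 w ≠ 0 := by
      by_contra! H
      exact h0 (Subtype.ext (ContinuousLinearMap.ext H))
    ext z
    by_contra hbz
    obtain ⟨g, -, hg⟩ := exists_dual_vector 𝕜 (b.1 z) (norm_ne_zero_iff.mpr hbz)
    -- As `b z` lies in the kernel of `e`, this `x` sends it to `‖b z‖` times the nonzero vector `e
    -- w`.
    obtain ⟨x, hx, hx', hxz⟩ := key (g.comp (ContinuousLinearMap.id 𝕜 X - e.1)) (e.1 w)
      (fun z => by simp [ee]) (ee w)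
    have h3 : x.1 (b.1 z) = 0 := congrArg (fun T => T.1 z) (hb x hx hx')
    have h5 : e.1 (b.1 z) = 0 := congrArg (fun T => T.1 z) heb
    rw [hxz] at h3
    have h4 := (smul_eq_zero.mp h3).resolve_right hw
    simp only [ContinuousLinearMap.comp_apply, _root_.sub_apply, h5, sub_zero,
      ContinuousLinearMap.id_apply, hg] at h4
    exact hbz (by simpa using h4)

/-- The projection onto a nontrivial complemented element of a nest is a faithful idempotent. -/
theorem exists_isFaithfulIdempotent_of_closedComplemented (hN : IsNest N) {M : Submodule 𝕜 X}
    (hM : M ∈ N) (hbot : M ≠ ⊥) (htop : M ≠ ⊤) (hc : M.ClosedComplemented) :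
    ∃ e : nestAlgebra N, IsFaithfulIdempotent e := by
  obtain ⟨p, hp⟩ := hc
  have hfix : ∀ x ∈ M, (p x : X) = x := fun x hx => congrArg Subtype.val (hp ⟨x, hx⟩)
  have hmem : M.subtypeL.comp p ∈ nestAlgebra N := by
    intro K hK x hx
    change (p x : X) ∈ K
    rcases hN.isChain.total hK hM with h | h
    · rwa [hfix x (h hx)]
    · exact h (p x).2
  refine ⟨⟨_, hmem⟩, isFaithfulIdempotent_of_rankOne _ ?_ ?_ ?_ ?_ ?_⟩
  · ext z
    exact hfix _ (p z).2
  · intro h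
    refine hbot ((Submodule.eq_bot_iff _).mpr fun x hx => ?_)
    rw [← hfix x hx]
    exact congrArg (fun T => T.1 x) h
  · intro h
    refine htop (Submodule.eq_top_iff'.mpr fun x => ?_)
    have h1 : (p x : X) = x := congrArg (fun T => T.1 x) h
    exact h1 ▸ (p x).2
  · intro f u hf hu K hK x hx
    change f x • u ∈ K
    have huM : u ∈ M := by
      have h1 : (p u : X) = u := hu
      exact h1 ▸ (p u).2
    rcases hN.isChain.total hK hM with h | h
    · have h1 : f (p x : X) = 0 := hf x
      rw [hfix x (h hx)] at h1
      rw [h1, zero_smul]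
      exact K.zero_mem
    · exact K.smul_mem _ (h huM)
  · intro x y _ _ hy hy'
    -- Here `(1 - e) R e = 0`: `y` maps the range of `e`, which is `M`, into itself.
    refine fun _ => Or.inr ?_
    ext z
    have h1 : y.1 (p z : X) = y.1 z := congrArg (fun T => T.1 z) hy'
    have h2 : (p (y.1 z) : X) = 0 := congrArg (fun T => T.1 z) hy
    rw [hfix _ (h1 ▸ y.2 M hM _ (p z).2)] at h2
    exact h2

theorem isGeneralizedHigherDerivation_of_nestAlgebra
    (hR : ∀ τ : ℕ → nestAlgebra N →+ nestAlgebra N,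
      IsJordanHigherDerivation τ → IsHigherDerivation τ)
    (δ : ℕ → nestAlgebra N →+ nestAlgebra N)
    (hδ : IsGeneralizedJordanHigherDerivation δ ∨ IsGeneralizedJordanTripleHigherDerivation δ) :
    IsGeneralizedHigherDerivation δ := by
  rcases hδ with h | h
  · exact h.isGeneralizedHigherDerivation hR
  · exact (h.isGeneralizedJordanHigherDerivation
      nestAlgebra_eq_zero_of_add_self).isGeneralizedHigherDerivation hR

/-! ### The Hilbert space case. -/

variable {H : Type*} [NormedAddCommGroup H] [InnerProductSpace 𝕜 H] {L : Set (Submodule 𝕜 H)}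

/-- If the nest is trivial, the algebra has a faithful rank-one projection or is commutative. -/
theorem exists_isFaithfulIdempotent_or_comm (hL : ∀ T : H →L[𝕜] H, T ∈ nestAlgebra L) :
    (∃ e : nestAlgebra L, IsFaithfulIdempotent e) ∨ ∀ a b : nestAlgebra L, a * b = b * a := by
  by_cases hex : ∃ u v : H, ‖u‖ = 1 ∧ v ≠ 0 ∧ inner 𝕜 u v = 0
  · obtain ⟨u, v, hu, hv, huv⟩ := hex
    left
    have huu : inner 𝕜 u u = (1 : 𝕜) := by simp [inner_self_eq_norm_sq_to_K, hu]
    have hu0 : u ≠ 0 := fun h => by simp [h] at hu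
    refine ⟨⟨(innerSL 𝕜 u).smulRight u, hL _⟩,
      isFaithfulIdempotent_of_rankOne _ ?_ ?_ ?_ (fun f u _ _ => hL _) ?_⟩
    · ext z
      change inner 𝕜 u (inner 𝕜 u z • u) • u = inner 𝕜 u z • u
      rw [inner_smul_right, huu, mul_one]
    · intro h
      have h1 : inner 𝕜 u u • u = (0 : H) := congrArg (fun T => T.1 u) h
      rw [huu, one_smul] at h1
      exact hu0 h1
    · intro h
      have h1 : inner 𝕜 u v • u = v := congrArg (fun T => T.1 v) h
      rw [huv, zero_smul] at h1
      exact hv h1.symm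
    -- The range of `x` lies in the line of `u` and `y` is determined by `y u`, so `y * x = 0`
    -- leaves only `y u = 0` or `x = 0`.
    · intro x y hx _ _ hy hyx
      by_cases hyu : y.1 u = 0
      · right
        ext z
        have h1 : y.1 (inner 𝕜 u z • u) = y.1 z := congrArg (fun T => T.1 z) hy
        rw [← h1, map_smul, hyu, smul_zero]
        rfl
      · left
        ext z
        have h1 : inner 𝕜 u (x.1 z) • u = x.1 z := congrArg (fun T => T.1 z) hx
        have h3 : y.1 (x.1 z) = 0 := congrArg (fun T => T.1 z) hyx
        rw [← h1, map_smul] at h3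
        rw [← h1, (smul_eq_zero.mp h3).resolve_right hyu, zero_smul]
        rfl
  · right
    push Not at hex
    intro a b
    ext w
    change a.1 (b.1 w) = b.1 (a.1 w)
    rcases eq_or_ne w 0 with rfl | hw
    · simp
    · have key : ∀ z : H, ∃ c : 𝕜, z = c • w := fun z => by
        -- The coefficient of the projection of `z` onto `w`; a nonzero remainder, paired with the
        -- normalized `w`, would contradict `hex`.
        refine ⟨inner 𝕜 w z / inner 𝕜 w w, ?_⟩
        by_contra hz
        refine hex (((‖w‖⁻¹ : ℝ) : 𝕜) • w) (z - (inner 𝕜 w z / inner 𝕜 w w) • w)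
          ?_ (sub_ne_zero.mpr hz) ?_
        · rw [norm_smul, RCLike.norm_ofReal, abs_inv, abs_norm,
            inv_mul_cancel₀ (norm_ne_zero_iff.mpr hw)]
        · rw [inner_smul_left, inner_sub_right, inner_smul_right,
            div_mul_cancel₀ _ (inner_self_ne_zero.mpr hw), sub_self, mul_zero]
      obtain ⟨s, hs⟩ := key (a.1 w)
      obtain ⟨t, ht⟩ := key (b.1 w)
      rw [hs, ht, map_smul, map_smul, hs, ht, smul_comm]

theorem isJordanHigherDerivation_isHigherDerivation_of_hilbert [CompleteSpace H]
    (hL : IsNest L) (τ : ℕ → nestAlgebra L →+ nestAlgebra L)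
    (hτ : IsJordanHigherDerivation τ) : IsHigherDerivation τ := by
  have h2 := nestAlgebra_eq_zero_of_add_self (N := L)
  by_cases hM : ∃ M ∈ L, M ≠ ⊥ ∧ M ≠ ⊤
  · obtain ⟨M, hM, hbot, htop⟩ := hM
    have : CompleteSpace M := (hL.isClosed M hM).completeSpace_coe
    obtain ⟨e, he⟩ := exists_isFaithfulIdempotent_of_closedComplemented hL hM hbot htop
      ⟨M.orthogonalProjectionOnto, fun x => M.orthogonalProjectionOnto_mem_subspace_eq_self x⟩
    exact hτ.isHigherDerivation h2 he
  · push Not at hM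
    have hall : ∀ T : H →L[𝕜] H, T ∈ nestAlgebra L := fun T K hK x hx => by
      by_cases hb : K = ⊥
      · subst hb
        simp [(Submodule.mem_bot 𝕜).mp hx]
      · rw [hM K hK hb]
        trivial
    rcases exists_isFaithfulIdempotent_or_comm hall with ⟨e, he⟩ | hc
    · exact hτ.isHigherDerivation h2 he
    · exact hτ.isHigherDerivation_of_comm h2 hc

end NestAlgebras

theorem theorem3p3 {𝕜 : Type*} [RCLike 𝕜] :
    (∀ (X : Type*) [NormedAddCommGroup X] [NormedSpace 𝕜 X] [CompleteSpace X]
      (N : Set (Submodule 𝕜 X)), IsNest N →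
      (∃ M ∈ N, M ≠ ⊥ ∧ M ≠ ⊤ ∧ M.ClosedComplemented) →
      ∀ δ : ℕ → nestAlgebra N →+ nestAlgebra N,
        (IsGeneralizedJordanHigherDerivation δ ∨
          IsGeneralizedJordanTripleHigherDerivation δ) →
        IsGeneralizedHigherDerivation δ) ∧
    (∀ (H : Type*) [NormedAddCommGroup H] [InnerProductSpace 𝕜 H] [CompleteSpace H]
      (N : Set (Submodule 𝕜 H)), IsNest N →
      ∀ δ : ℕ → nestAlgebra N →+ nestAlgebra N,
        (IsGeneralizedJordanHigherDerivation δ ∨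
          IsGeneralizedJordanTripleHigherDerivation δ) →
        IsGeneralizedHigherDerivation δ) := by
  constructor
  · intro X _ _ _ N hN hM δ hδ
    obtain ⟨M, hM, hbot, htop, hc⟩ := hM
    obtain ⟨e, he⟩ := exists_isFaithfulIdempotent_of_closedComplemented hN hM hbot htop hc
    exact isGeneralizedHigherDerivation_of_nestAlgebra
      (fun τ hτ => hτ.isHigherDerivation nestAlgebra_eq_zero_of_add_self he) δ hδ
  · intro H _ _ _ N hN δ hδ
    exact isGeneralizedHigherDerivation_of_nestAlgebra
      (isJordanHigherDerivation_isHigherDerivation_of_hilbert hN) δ hδ
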